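/- Let $\mathbb D=\{z\in\mathbb C:|z|<1\}$, let $\alpha>-1$, and let $H\neq\{0\}$ be a separable complex Hilbert space. Let $dA_\alpha(z)=(\alpha+1)(1-|z|^2)^\alpha\,dA(z)$, where $dA$ is the normalized area measure on $\mathbb D$, and let $\mathcal A^2_\alpha(H)$ be the Hilbert space of all analytic functions $f:\mathbb D\to H$ (that is, $f(z)=\sum_{n\ge 0}y_nz^n$ on $\mathbb D$ with $y_n\in H$) such that $\|f\|^2=\int_{\mathbb D}\|f(z)\|^2\,dA_\alpha(z)<\infty$, with the inner product $\langle f,g\rangle=\int_{\mathbb D}\langle f(z),g(z)\rangle\,dA_\alpha(z)$. Let $\Phi:\mathbb D\to\mathbb D$ be analytic, and let $C_\Phi f=f\circ\Phi$ be the composition operator on $\mathcal A^2_\alpha(H)$. Then $C_\Phi$ is Hermitian on $\mathcal A^2_\alpha(H)$ (that is, $C_\Phi$ is a bounded linear operator on $\mathcal A^2_\alpha(H)$ with $C_\Phi^*=C_\Phi$) if and only if there is a real number $\lambda$ with $|\lambda|\le 1$ such that $\Phi(z)=\lambda z$ for all $z\in\mathbb D$. -/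

import Mathlib

open MeasureTheory Filter Topology
open scoped ENNReal

/-- The open unit disc of the complex plane, with the topology and the σ-algebra inherited
from `ℂ`. -/
abbrev Disc : Type := Metric.ball (0 : ℂ) 1

/-- A function on the unit disc is analytic if it is the sum of a power series centred at `0`
that converges on the whole disc. -/
def IsAnalyticOnDisc {E : Type*} [NormedAddCommGroup E] [NormedSpace ℂ E] (f : Disc → E) : Prop :=
  ∃ y : ℕ → E, ∀ z : Disc, HasSum (fun n => (z : ℂ) ^ n • y n) (f z)

/-- The measure `dA_α(z) = (α + 1) (1 - |z|²)^α dA(z)` on the unit disc, where `dA` is the area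
measure normalized to have total mass one, that is, Lebesgue measure divided by `π`. -/
noncomputable def weightedArea (α : ℝ) : Measure Disc :=
  (Measure.comap ((↑) : Disc → ℂ) volume).withDensity
    (fun z => ENNReal.ofReal ((α + 1) / Real.pi * (1 - ‖(z : ℂ)‖ ^ 2) ^ α))

/-- Extension of a function on the disc by zero. -/
noncomputable def discExtend {E : Type*} [Zero E] (f : Disc → E) (z : ℂ) : E :=
  open Classical in if h : z ∈ Metric.ball (0 : ℂ) 1 then f ⟨z, h⟩ else 0

theorem discExtend_coe {E : Type*} [Zero E] (f : Disc → E) (z : Disc) : discExtend f z = f z := by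
  simp only [discExtend, z.2, dif_pos]

section Analytic

variable {E : Type*} [NormedAddCommGroup E] [NormedSpace ℂ E]

theorem isAnalyticOnDisc_zero : IsAnalyticOnDisc (0 : Disc → E) :=
  ⟨0, fun z => by simp [hasSum_zero]⟩

theorem IsAnalyticOnDisc.add {f g : Disc → E} (hf : IsAnalyticOnDisc f) (hg : IsAnalyticOnDisc g) :
    IsAnalyticOnDisc (f + g) := by
  obtain ⟨y, hy⟩ := hf
  obtain ⟨s, hs⟩ := hg
  exact ⟨y + s, fun z => by simpa [smul_add] using (hy z).add (hs z)⟩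

theorem IsAnalyticOnDisc.smul {f : Disc → E} (c : ℂ) (hf : IsAnalyticOnDisc f) :
    IsAnalyticOnDisc (c • f) := by
  obtain ⟨y, hy⟩ := hf
  refine ⟨c • y, fun z => ?_⟩
  have := (hy z).const_smul c
  simpa [smul_comm c] using this

theorem IsAnalyticOnDisc.differentiableOn [CompleteSpace E] {f : Disc → E}
    (hf : IsAnalyticOnDisc f) :
    DifferentiableOn ℂ (discExtend f) (Metric.ball 0 1) := by
  obtain ⟨y, hy⟩ := hf
  let p : FormalMultilinearSeries ℂ ℂ E := fun n =>
    ContinuousMultilinearMap.mkPiRing ℂ (Fin n) (y n)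
  have hp : HasFPowerSeriesOnBall (discExtend f) p 0 1 := by
    refine ⟨?_, zero_lt_one, ?_⟩
    · refine ENNReal.le_of_forall_nnreal_lt fun r hr => ?_
      have hr1 : (r : ℝ) < 1 := by exact_mod_cast hr
      have hz : ((r : ℝ) : ℂ) ∈ Metric.ball (0 : ℂ) 1 := by simpa using hr1
      refine p.le_radius_of_tendsto (l := 0) ?_
      have := (hy ⟨_, hz⟩).summable.tendsto_atTop_zero.norm
      simpa [p, norm_smul, mul_comm] using this
    · intro z hz
      have hz' : z ∈ Metric.ball (0 : ℂ) 1 := by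
        simpa [← ENNReal.ofReal_one, Metric.eball_ofReal] using hz
      have := hy ⟨z, hz'⟩
      rw [zero_add, ← discExtend_coe f ⟨z, hz'⟩] at *
      simpa [p] using this
  have := hp.differentiableOn
  simpa [← ENNReal.ofReal_one, Metric.eball_ofReal] using this

theorem isAnalyticOnDisc_of_differentiableOn [CompleteSpace E] {f : Disc → E}
    (hf : DifferentiableOn ℂ (discExtend f) (Metric.ball 0 1)) : IsAnalyticOnDisc f := by
  refine ⟨fun n => (n.factorial : ℂ)⁻¹ • iteratedDeriv n (discExtend f) 0, fun z => ?_⟩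
  have := Complex.hasSum_taylorSeries_on_ball hf z.2
  rw [discExtend_coe] at this
  simp only [sub_zero] at this
  have h2 := fun n : ℕ =>
    smul_comm ((z : ℂ) ^ n) ((n.factorial : ℂ)⁻¹) (iteratedDeriv n (discExtend f) 0)
  simp only [h2]
  exact this

theorem IsAnalyticOnDisc.continuous [CompleteSpace E] {f : Disc → E} (hf : IsAnalyticOnDisc f) :
    Continuous f := by
  have := continuousOn_iff_continuous_domRestrict.1 hf.differentiableOn.continuousOn
  convert this using 1
  ext z
  exact (discExtend_coe f z).symm

end Analytic

section PointEvaluation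

variable {E : Type*} [NormedAddCommGroup E] [NormedSpace ℂ E] [CompleteSpace E]

theorem measurable_enorm_discExtend {f : Disc → E} (hf : IsAnalyticOnDisc f) :
    Measurable (fun w => ‖discExtend f w‖ₑ) := by
  classical
  have h1 : ContinuousOn (fun w => ‖discExtend f w‖ₑ) (Metric.ball 0 1) :=
    hf.differentiableOn.continuousOn.enorm
  have h2 := h1.measurable_piecewise (g := fun _ => 0) continuousOn_const
    Metric.isOpen_ball.measurableSet
  convert h2 using 1
  ext w
  by_cases hw : w ∈ Metric.ball (0 : ℂ) 1
  · simp only [Set.piecewise_eq_of_mem _ _ _ hw]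
  · rw [Set.piecewise_eq_of_notMem _ _ _ hw]
    simp only [discExtend, dif_neg hw, enorm_zero]

theorem enorm_le_lintegral_circle {f : Disc → E} (hf : IsAnalyticOnDisc f) {z : ℂ} {s : ℝ}
    (hs : 0 < s) (hz : Metric.closedBall z s ⊆ Metric.ball 0 1) :
    ENNReal.ofReal (2 * Real.pi) * ‖discExtend f z‖ₑ ≤
      ∫⁻ θ in Set.Ioo (-Real.pi) Real.pi, ‖discExtend f (circleMap z s θ)‖ₑ := by
  have h1 : DiffContOnCl ℂ (discExtend f) (Metric.ball z |s|) := by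
    rw [abs_of_pos hs]
    refine (hf.differentiableOn.mono ?_).diffContOnCl
    rwa [closure_ball z hs.ne']
  have h2 := h1.circleAverage
  have h3 : (2 * Real.pi) • discExtend f z =
      ∫ θ in Set.Ioo (-Real.pi) Real.pi, discExtend f (circleMap z s θ) := by
    rw [← h2, Real.circleAverage, smul_inv_smul₀ Real.two_pi_pos.ne', ← integral_Ioc_eq_integral_Ioo,
      ← intervalIntegral.integral_of_le (by linarith [Real.pi_pos])]
    have hper : Function.Periodic (fun θ => discExtend f (circleMap z s θ)) (2 * Real.pi) :=
      fun θ => congrArg (discExtend f) (periodic_circleMap z s θ)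
    have := hper.intervalIntegral_add_eq 0 (-Real.pi)
    rw [zero_add] at this
    rw [this]
    congr 1
    ring
  calc ENNReal.ofReal (2 * Real.pi) * ‖discExtend f z‖ₑ
      = ‖(2 * Real.pi) • discExtend f z‖ₑ := by
        rw [enorm_smul, Real.enorm_of_nonneg Real.two_pi_pos.le]
    _ ≤ _ := by
        rw [h3]
        exact enorm_integral_le_lintegral_enorm _

theorem exists_enorm_le_lintegral_ball {ρ : ℝ} (hρ : 0 < ρ) :
    ∃ c : ℝ≥0∞, c ≠ 0 ∧ c ≠ ∞ ∧ ∀ f : Disc → E, IsAnalyticOnDisc f → ∀ z : ℂ,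
      Metric.ball z ρ ⊆ Metric.ball 0 1 →
        c * ‖discExtend f z‖ₑ ≤ ∫⁻ w in Metric.ball z ρ, ‖discExtend f w‖ₑ := by
  have hc0 : (∫⁻ s in Set.Ioo 0 ρ, ENNReal.ofReal s) ≠ 0 := by
    rw [Ne, lintegral_eq_zero_iff (by fun_prop), EventuallyEq,
      ae_restrict_iff' measurableSet_Ioo]
    intro h
    have h' : volume (Set.Ioo 0 ρ) = 0 := by
      refine measure_mono_null ?_ h
      intro s hs
      simpa using ⟨hs.1, hs.2, hs.1⟩
    simp at h'
    linarith
  have hct : (∫⁻ s in Set.Ioo 0 ρ, ENNReal.ofReal s) ≠ ∞ := by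
    refine (lt_of_le_of_lt (setLIntegral_mono (g := fun _ => ENNReal.ofReal ρ) (by fun_prop)
      fun s hs => ENNReal.ofReal_le_ofReal hs.2.le) ?_).ne
    simp [ENNReal.mul_lt_top]
  refine ⟨(∫⁻ s in Set.Ioo 0 ρ, ENNReal.ofReal s) * ENNReal.ofReal (2 * Real.pi), ?_, ?_, ?_⟩
  · exact mul_ne_zero hc0 (by simp [Real.pi_pos])
  · exact ENNReal.mul_ne_top hct ENNReal.ofReal_ne_top
  intro f hf z hz
  set g : ℂ → ℝ≥0∞ := fun w => ‖discExtend f w‖ₑ with hg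
  have hgm : Measurable g := measurable_enorm_discExtend hf
  have hpol : ∀ p : ℝ × ℝ, z + Complex.polarCoord.symm p = circleMap z p.1 p.2 := fun p => by
    rw [Complex.polarCoord_symm_apply, circleMap, Complex.exp_mul_I]
    simp
  set F : ℂ → ℝ≥0∞ := (Metric.ball z ρ).indicator g with hF
  have hFm : Measurable F := hgm.indicator Metric.isOpen_ball.measurableSet
  calc (∫⁻ s in Set.Ioo 0 ρ, ENNReal.ofReal s) * ENNReal.ofReal (2 * Real.pi) * g z
      = ∫⁻ s in Set.Ioo 0 ρ, ENNReal.ofReal s * (ENNReal.ofReal (2 * Real.pi) * g z) := by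
        rw [lintegral_mul_const _ (by fun_prop), mul_assoc]
    _ ≤ ∫⁻ s in Set.Ioo 0 ρ, ∫⁻ θ in Set.Ioo (-Real.pi) Real.pi,
          ENNReal.ofReal s * F (circleMap z s θ) := by
        refine setLIntegral_mono' measurableSet_Ioo fun s hs => ?_
        have hm : Measurable fun θ => F (circleMap z s θ) :=
          hFm.comp (continuous_circleMap z s).measurable
        rw [lintegral_const_mul _ hm]
        refine mul_le_mul_right ?_ _
        refine (enorm_le_lintegral_circle hf hs.1
          ((Metric.closedBall_subset_ball hs.2).trans hz)).trans (le_of_eq ?_)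
        refine lintegral_congr fun θ => ?_
        rw [hF, Set.indicator_of_mem]
        rw [mem_ball_iff_norm, circleMap_sub_center]
        simp [abs_of_pos hs.1, hs.2]
    _ ≤ ∫⁻ s in Set.Ioi 0, ∫⁻ θ in Set.Ioo (-Real.pi) Real.pi,
          ENNReal.ofReal s * F (circleMap z s θ) :=
        lintegral_mono_set Set.Ioo_subset_Ioi_self
    _ = ∫⁻ p in polarCoord.target, ENNReal.ofReal p.1 • F (z + Complex.polarCoord.symm p) := by
        rw [polarCoord_target, Measure.volume_eq_prod, ← Measure.prod_restrict, lintegral_prod]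
        · simp only [hpol, smul_eq_mul]
        · simp only [hpol, smul_eq_mul]
          refine (Measurable.mul (by fun_prop) (hFm.comp ?_)).aemeasurable
          unfold circleMap
          fun_prop
    _ = ∫⁻ w, F (z + w) := Complex.lintegral_comp_polarCoord_symm (fun w => F (z + w))
    _ = ∫⁻ w, F w := lintegral_add_left_eq_self F z
    _ = ∫⁻ w in Metric.ball z ρ, g w := by
        rw [hF, lintegral_indicator Metric.isOpen_ball.measurableSet]

end PointEvaluation

section Weight

theorem weight_bounds {α : ℝ} (hα : -1 < α) {r : ℝ} (hr : r < 1) :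
    ∃ m M : ℝ, 0 < m ∧ ∀ z : ℂ, ‖z‖ ≤ r →
      m ≤ (α + 1) / Real.pi * (1 - ‖z‖ ^ 2) ^ α ∧ (α + 1) / Real.pi * (1 - ‖z‖ ^ 2) ^ α ≤ M := by
  rcases lt_or_ge r 0 with h0 | h0
  · exact ⟨1, 1, one_pos, fun z hz => absurd (norm_nonneg z) (by linarith)⟩
  have hpos : ∀ z ∈ Metric.closedBall (0 : ℂ) r, 0 < 1 - ‖z‖ ^ 2 := fun z hz => by
    have : ‖z‖ ≤ r := by simpa using hz
    nlinarith [norm_nonneg z]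
  have hc : ContinuousOn (fun z : ℂ => (α + 1) / Real.pi * (1 - ‖z‖ ^ 2) ^ α)
      (Metric.closedBall 0 r) := by
    refine continuousOn_const.mul (ContinuousOn.rpow_const (by fun_prop) fun z hz => ?_)
    exact Or.inl (hpos z hz).ne'
  have hne : (Metric.closedBall (0 : ℂ) r).Nonempty := ⟨0, by simpa using h0⟩
  obtain ⟨a, ha, ha'⟩ := (isCompact_closedBall (0 : ℂ) r).exists_isMinOn hne hc
  obtain ⟨b, _, hb'⟩ := (isCompact_closedBall (0 : ℂ) r).exists_isMaxOn hne hc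
  refine ⟨_, _, ?_, fun z hz => ⟨ha' (by simpa using hz), hb' (by simpa using hz)⟩⟩
  exact mul_pos (div_pos (by linarith) Real.pi_pos) (Real.rpow_pos_of_pos (hpos a ha) _)

variable {E : Type*} [NormedAddCommGroup E] [NormedSpace ℂ E] [CompleteSpace E]

theorem exists_enorm_le_eLpNorm {α : ℝ} (hα : -1 < α) {r : ℝ} (hr : r < 1) :
    ∃ C : ℝ≥0∞, C ≠ ∞ ∧ ∀ f : Disc → E, IsAnalyticOnDisc f → ∀ z : Disc, ‖(z : ℂ)‖ ≤ r →
      ‖f z‖ₑ ≤ C * eLpNorm f 2 (weightedArea α) := by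
  obtain ⟨m, M, hm, hmM⟩ := weight_bounds hα (r := (1 + r) / 2) (by linarith)
  obtain ⟨c, hc0, hct, hc⟩ := exists_enorm_le_lintegral_ball (E := E) (ρ := (1 - r) / 2)
    (by linarith)
  set S : Set Disc := {w | ‖(w : ℂ)‖ ≤ (1 + r) / 2} with hS
  have hSm : MeasurableSet S := measurableSet_le (by fun_prop) measurable_const
  have hemb : MeasurableEmbedding ((↑) : Disc → ℂ) :=
    MeasurableEmbedding.subtype_coe Metric.isOpen_ball.measurableSet
  set ν : Measure Disc := Measure.comap ((↑) : Disc → ℂ) volume with hν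
  have hνfin : ν S ≠ ∞ := by
    rw [hν, hemb.comap_apply]
    have hsub : ((↑) : Disc → ℂ) '' S ⊆ Metric.ball 0 1 := by
      rintro _ ⟨v, -, rfl⟩
      exact v.2
    exact ((measure_mono hsub).trans_lt measure_ball_lt_top).ne
  have hμS : weightedArea α S ≠ ∞ := by
    rw [weightedArea, withDensity_apply _ hSm]
    refine (lt_of_le_of_lt (setLIntegral_mono (s := S)
      (g := fun _ : Disc => ENNReal.ofReal M) (by fun_prop) fun w hw => ENNReal.ofReal_le_ofReal (hmM w hw).2) ?_).ne
    rw [setLIntegral_const]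
    exact ENNReal.mul_lt_top ENNReal.ofReal_lt_top (lt_top_iff_ne_top.2 hνfin)
  have hwm : Measurable fun w : Disc =>
      ENNReal.ofReal ((α + 1) / Real.pi * (1 - ‖(w : ℂ)‖ ^ 2) ^ α) := by fun_prop
  refine ⟨c⁻¹ * ((ENNReal.ofReal m)⁻¹ * (weightedArea α S) ^ (1 / 2 : ℝ)), ?_, ?_⟩
  · refine ENNReal.mul_ne_top (ENNReal.inv_ne_top.2 hc0) (ENNReal.mul_ne_top ?_ ?_)
    · exact ENNReal.inv_ne_top.2 (by simpa using hm)
    · exact ENNReal.rpow_ne_top_of_nonneg (by norm_num) hμS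
  intro f hf z hz
  have hball : Metric.ball (z : ℂ) ((1 - r) / 2) ⊆ Metric.closedBall 0 ((1 + r) / 2) := by
    intro w hw
    rw [mem_ball_iff_norm] at hw
    rw [mem_closedBall_zero_iff]
    have := norm_add_le (w - z) (z : ℂ)
    rw [sub_add_cancel] at this
    linarith
  have hball' : Metric.closedBall (0 : ℂ) ((1 + r) / 2) ⊆ Metric.ball 0 1 :=
    Metric.closedBall_subset_ball (by linarith)
  have h1 := hc f hf z (hball.trans hball')
  rw [discExtend_coe] at h1
  have h2 : ∫⁻ w in Metric.ball (z : ℂ) ((1 - r) / 2), ‖discExtend f w‖ₑ ≤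
      ∫⁻ w in S, ‖f w‖ₑ ∂ν := by
    refine (lintegral_mono_set hball).trans (le_of_eq ?_)
    have hS' : ((↑) : Disc → ℂ) '' S = Metric.closedBall 0 ((1 + r) / 2) := by
      ext w
      constructor
      · rintro ⟨v, hv, rfl⟩
        simpa [hS] using hv
      · intro hw
        exact ⟨⟨w, hball' hw⟩, by simpa [hS] using hw, rfl⟩
    simp only [← discExtend_coe f]
    rw [← hS', hν, hemb.restrict_comap, ← hemb.lintegral_map (fun x => ‖discExtend f x‖ₑ),
      hemb.map_comap, Measure.restrict_restrict hemb.measurableSet_range,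
      Set.inter_eq_right.2 (Set.image_subset_range _ _)]
  have h3 : ENNReal.ofReal m * ∫⁻ w in S, ‖f w‖ₑ ∂ν ≤ ∫⁻ w in S, ‖f w‖ₑ ∂(weightedArea α) := by
    have hfm : Measurable fun w => ‖f w‖ₑ := hf.continuous.enorm.measurable
    rw [weightedArea, setLIntegral_withDensity_eq_setLIntegral_mul _ hwm hfm hSm,
      ← lintegral_const_mul _ hfm]
    refine setLIntegral_mono' hSm fun w hw => ?_
    exact mul_le_mul_left (ENNReal.ofReal_le_ofReal (hmM w hw).1) _
  have h4 : ∫⁻ w in S, ‖f w‖ₑ ∂(weightedArea α) ≤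
      eLpNorm f 2 (weightedArea α) * (weightedArea α S) ^ (1 / 2 : ℝ) := by
    rw [← eLpNorm_one_eq_lintegral_enorm]
    have := eLpNorm_le_eLpNorm_mul_rpow_measure_univ (p := 1) (q := 2)
      (μ := (weightedArea α).restrict S) one_le_two hf.continuous.aestronglyMeasurable
    refine this.trans ?_
    rw [Measure.restrict_apply_univ]
    norm_num
    gcongr
    exact Measure.restrict_le_self
  have hm0 : ENNReal.ofReal m ≠ 0 := by simpa using hm
  calc ‖f z‖ₑ ≤ c⁻¹ * ∫⁻ w in S, ‖f w‖ₑ ∂ν := by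
        rw [← ENNReal.mul_le_iff_le_inv hc0 hct]
        exact h1.trans h2
    _ ≤ c⁻¹ * ((ENNReal.ofReal m)⁻¹ * ∫⁻ w in S, ‖f w‖ₑ ∂(weightedArea α)) := by
        gcongr
        rw [← ENNReal.mul_le_iff_le_inv hm0 ENNReal.ofReal_ne_top]
        exact h3
    _ ≤ c⁻¹ * ((ENNReal.ofReal m)⁻¹ *
          (eLpNorm f 2 (weightedArea α) * (weightedArea α S) ^ (1 / 2 : ℝ))) := by gcongr
    _ = _ := by ring

end Weight

section Space

variable (α : ℝ) (H : Type*) [NormedAddCommGroup H] [InnerProductSpace ℂ H] [CompleteSpace H]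

variable {H} in
theorem IsAnalyticOnDisc.memLp_iff {f : Disc → H} (hf : IsAnalyticOnDisc f) :
    MemLp f 2 (weightedArea α) ↔ ∫⁻ z, ‖f z‖ₑ ^ 2 ∂(weightedArea α) < ∞ := by
  rw [MemLp, and_iff_right hf.continuous.aestronglyMeasurable,
    eLpNorm_lt_top_iff_lintegral_rpow_enorm_lt_top two_ne_zero ENNReal.ofNat_ne_top]
  simp

/-- The `H`-valued weighted Bergman space `A²_α(H)` as a space of functions: the analytic functions
`f` on the disc with `∫ ‖f‖² dA_α < ∞`. -/
noncomputable def bergmanSubmodule : Submodule ℂ (Disc → H) where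
  carrier := {f | IsAnalyticOnDisc f ∧ ∫⁻ z, ‖f z‖ₑ ^ 2 ∂(weightedArea α) < ∞}
  zero_mem' := ⟨isAnalyticOnDisc_zero, by simp⟩
  add_mem' := fun {f g} hf hg => ⟨hf.1.add hg.1, ((hf.1.add hg.1).memLp_iff α).1
    (((hf.1.memLp_iff α).2 hf.2).add ((hg.1.memLp_iff α).2 hg.2))⟩
  smul_mem' := fun c f hf => ⟨hf.1.smul c, ((hf.1.smul c).memLp_iff α).1
    (((hf.1.memLp_iff α).2 hf.2).const_smul c)⟩

/-- The `H`-valued weighted Bergman space `A²_α(H)`. It is a type synonym of the submodule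
of functions, so that it carries the Bergman norm and not the topology of pointwise convergence. -/
def BergmanSpace : Type _ := bergmanSubmodule α H

namespace BergmanSpace

noncomputable instance : AddCommGroup (BergmanSpace α H) :=
  inferInstanceAs (AddCommGroup (bergmanSubmodule α H))

noncomputable instance : Module ℂ (BergmanSpace α H) :=
  inferInstanceAs (Module ℂ (bergmanSubmodule α H))

instance : CoeFun (BergmanSpace α H) (fun _ => Disc → H) := ⟨fun f => f.1⟩

variable {α H}

theorem isAnalytic (f : BergmanSpace α H) : IsAnalyticOnDisc (f : Disc → H) := f.2.1

theorem memLp (f : BergmanSpace α H) : MemLp (f : Disc → H) 2 (weightedArea α) :=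
  (f.isAnalytic.memLp_iff α).2 f.2.2

/-- The inner product `∫ ⟪f(z), g(z)⟫ dA_α(z)`; as everywhere in Mathlib, inner products are
conjugate-linear in the first variable. -/
noncomputable instance : Inner ℂ (BergmanSpace α H) :=
  ⟨fun f g => ∫ z, inner ℂ (f z) (g z) ∂(weightedArea α)⟩

theorem inner_def (f g : BergmanSpace α H) :
    inner ℂ f g = ∫ z, inner ℂ (f z) (g z) ∂(weightedArea α) := rfl

theorem inner_eq_inner_toLp (f g : BergmanSpace α H) :
    inner ℂ f g = inner ℂ (f.memLp.toLp f) (g.memLp.toLp g) := by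
  rw [inner_def, L2.inner_def]
  refine integral_congr_ae ?_
  filter_upwards [f.memLp.coeFn_toLp, g.memLp.coeFn_toLp] with z h1 h2
  rw [h1, h2]

theorem eq_zero_of_eLpNorm [hα : Fact (-1 < α)] (f : BergmanSpace α H)
    (hf : eLpNorm (f : Disc → H) 2 (weightedArea α) = 0) : f = 0 := by
  refine Subtype.ext (funext fun z => ?_)
  have hz : ‖(z : ℂ)‖ < 1 := mem_ball_zero_iff.1 z.2
  obtain ⟨C, -, h⟩ := exists_enorm_le_eLpNorm (E := H) hα.out hz
  have h0 : f z = 0 := by simpa [hf] using h f f.isAnalytic z le_rfl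
  exact h0

/-- The inner product laws. -/
@[reducible]
noncomputable def core [hα : Fact (-1 < α)] : InnerProductSpace.Core ℂ (BergmanSpace α H) where
  conj_inner_symm f g := by
    rw [inner_eq_inner_toLp, inner_eq_inner_toLp]
    exact inner_conj_symm _ _
  re_inner_nonneg f := by
    rw [inner_eq_inner_toLp]
    exact inner_self_nonneg
  add_left f g h := by
    rw [inner_eq_inner_toLp, inner_eq_inner_toLp, inner_eq_inner_toLp, ← inner_add_left]
    rfl
  smul_left f g c := by
    rw [inner_eq_inner_toLp, inner_eq_inner_toLp, ← inner_smul_left]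
    rfl
  definite f hf := by
    rw [inner_eq_inner_toLp, inner_self_eq_zero, ← norm_eq_zero, Lp.norm_toLp,
      ENNReal.toReal_eq_zero_iff] at hf
    exact f.eq_zero_of_eLpNorm (hf.resolve_right f.memLp.2.ne)

noncomputable instance [Fact (-1 < α)] : NormedAddCommGroup (BergmanSpace α H) :=
  core.toNormedAddCommGroup

noncomputable instance [Fact (-1 < α)] : InnerProductSpace ℂ (BergmanSpace α H) :=
  InnerProductSpace.ofCore core.toCore

theorem inner_eq_integral [Fact (-1 < α)] (f g : BergmanSpace α H) :
    inner ℂ f g = ∫ z, inner ℂ (f z) (g z) ∂(weightedArea α) := rfl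

theorem enorm_eq_eLpNorm [Fact (-1 < α)] (f : BergmanSpace α H) :
    ‖f‖ₑ = eLpNorm (f : Disc → H) 2 (weightedArea α) := by
  have h : ‖f‖ = ‖f.memLp.toLp f‖ := by
    rw [norm_eq_sqrt_re_inner (𝕜 := ℂ), norm_eq_sqrt_re_inner (𝕜 := ℂ), ← inner_eq_inner_toLp]
  rw [← ofReal_norm, h, ofReal_norm, Lp.enorm_toLp]

theorem exists_enorm_apply_le [hα : Fact (-1 < α)] {r : ℝ} (hr : r < 1) :
    ∃ C : ℝ≥0∞, C ≠ ∞ ∧ ∀ f : BergmanSpace α H, ∀ z : Disc, ‖(z : ℂ)‖ ≤ r → ‖f z‖ₑ ≤ C * ‖f‖ₑ := by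
  obtain ⟨C, hC, h⟩ := exists_enorm_le_eLpNorm (E := H) hα.out hr
  exact ⟨C, hC, fun f z hz => by simpa only [enorm_eq_eLpNorm] using h f f.isAnalytic z hz⟩

instance [hα : Fact (-1 < α)] : CompleteSpace (BergmanSpace α H) := by
  refine Metric.complete_of_cauchySeq_tendsto fun u hu => ?_
  -- the sequence is uniformly Cauchy on every smaller closed disc
  have hunif : ∀ r : ℝ, r < 1 → ∀ ε : ℝ, 0 < ε → ∃ N, ∀ m ≥ N, ∀ n ≥ N, ∀ z : Disc,
      ‖(z : ℂ)‖ ≤ r → ‖u m z - u n z‖ < ε := by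
    intro r hr ε hε
    obtain ⟨C, hC, h⟩ := exists_enorm_apply_le (α := α) (H := H) hr
    obtain ⟨N, hN⟩ := Metric.cauchySeq_iff.1 hu (ε / (C.toReal + 1))
      (div_pos hε (by positivity))
    refine ⟨N, fun m hm n hn z hz => ?_⟩
    have h1 := h (u m - u n) z hz
    have h2 : ‖u m z - u n z‖ ≤ C.toReal * ‖u m - u n‖ := by
      have h3 := ENNReal.toReal_mono (ENNReal.mul_ne_top hC enorm_ne_top) h1
      rw [ENNReal.toReal_mul, toReal_enorm, toReal_enorm] at h3
      exact h3
    have h4 := hN m hm n hn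
    rw [dist_eq_norm, lt_div_iff₀ (by positivity)] at h4
    nlinarith [norm_nonneg (u m - u n)]
  have hlim : ∀ z : Disc, ∃ y, Tendsto (fun n => u n z) atTop (𝓝 y) := by
    intro z
    refine cauchySeq_tendsto_of_complete (Metric.cauchySeq_iff.2 fun ε hε => ?_)
    obtain ⟨N, hN⟩ := hunif ‖(z : ℂ)‖ (mem_ball_zero_iff.1 z.2) ε hε
    exact ⟨N, fun m hm n hn => by simpa only [dist_eq_norm] using hN m hm n hn z le_rfl⟩
  choose f hf using hlim
  have hfa : IsAnalyticOnDisc f := by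
    refine isAnalyticOnDisc_of_differentiableOn ?_
    refine TendstoLocallyUniformlyOn.differentiableOn (F := fun n => discExtend (u n))
      (φ := atTop) ?_ (Eventually.of_forall fun n => (u n).isAnalytic.differentiableOn)
      Metric.isOpen_ball
    rw [Metric.tendstoLocallyUniformlyOn_iff]
    intro ε hε z hz
    have hz' : ‖z‖ < 1 := mem_ball_zero_iff.1 hz
    obtain ⟨r, hr1, hr2⟩ := exists_between hz'
    refine ⟨Metric.ball 0 r, mem_nhdsWithin_of_mem_nhds
      (Metric.isOpen_ball.mem_nhds (mem_ball_zero_iff.2 hr1)), ?_⟩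
    obtain ⟨N, hN⟩ := hunif r hr2 (ε / 2) (half_pos hε)
    filter_upwards [eventually_ge_atTop N] with n hn w hw
    have hw' : ‖w‖ < r := mem_ball_zero_iff.1 hw
    have hw1 : w ∈ Metric.ball (0 : ℂ) 1 := mem_ball_zero_iff.2 (hw'.trans hr2)
    have e1 := discExtend_coe f ⟨w, hw1⟩
    have e2 := discExtend_coe (u n : Disc → H) ⟨w, hw1⟩
    simp only at e1 e2
    rw [e1, e2, dist_eq_norm]
    refine lt_of_le_of_lt ?_ (half_lt_self hε)
    refine le_of_tendsto ((hf ⟨w, hw1⟩).sub_const _).norm ?_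
    filter_upwards [eventually_ge_atTop N] with m hm
    exact (hN m hm n hn ⟨w, hw1⟩ hw'.le).le
  have hle : ∀ ε : ℝ, 0 < ε → ∃ N, ∀ n ≥ N,
      eLpNorm (f - (u n : Disc → H)) 2 (weightedArea α) ≤ ENNReal.ofReal ε := by
    intro ε hε
    obtain ⟨N, hN⟩ := Metric.cauchySeq_iff.1 hu ε hε
    refine ⟨N, fun n hn => ?_⟩
    refine (Lp.eLpNorm_lim_le_liminf_eLpNorm
      (f := fun m => (u m : Disc → H) - (u n : Disc → H))
      (fun m => ((u m).memLp.sub (u n).memLp).1) _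
      (Eventually.of_forall fun z => (hf z).sub_const _)).trans ?_
    refine liminf_le_of_frequently_le' (Eventually.frequently ?_)
    filter_upwards [eventually_ge_atTop N] with m hm
    have h1 : eLpNorm ((u m : Disc → H) - (u n : Disc → H)) 2 (weightedArea α) =
        ‖u m - u n‖ₑ := (enorm_eq_eLpNorm (u m - u n)).symm
    rw [h1, ← ofReal_norm, ← dist_eq_norm]
    exact ENNReal.ofReal_le_ofReal (hN m hm n hn).le
  have hfm : MemLp f 2 (weightedArea α) := by
    obtain ⟨N, hN⟩ := hle 1 one_pos
    have h1 : MemLp (f - (u N : Disc → H)) 2 (weightedArea α) :=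
      ⟨hfa.continuous.aestronglyMeasurable.sub (u N).memLp.1,
        (hN N le_rfl).trans_lt ENNReal.ofReal_lt_top⟩
    simpa using h1.add (u N).memLp
  let g : BergmanSpace α H := ⟨f, hfa, (hfa.memLp_iff α).1 hfm⟩
  refine ⟨g, Metric.tendsto_atTop.2 fun ε hε => ?_⟩
  obtain ⟨N, hN⟩ := hle (ε / 2) (half_pos hε)
  refine ⟨N, fun n hn => ?_⟩
  have h1 : ‖g - u n‖ₑ ≤ ENNReal.ofReal (ε / 2) := (enorm_eq_eLpNorm (g - u n)).trans_le (hN n hn)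
  rw [← ofReal_norm, ENNReal.ofReal_le_ofReal_iff (half_pos hε).le] at h1
  rw [dist_comm, dist_eq_norm]
  linarith

end BergmanSpace

/-- The bounded operator `T` on `A²_α(H)` is the composition operator `C_Φ f = f ∘ Φ`. -/
def IsCompositionOperator {α : ℝ} [Fact (-1 < α)] {H : Type*} [NormedAddCommGroup H]
    [InnerProductSpace ℂ H] [CompleteSpace H] (Φ : Disc → Disc)
    (T : BergmanSpace α H →L[ℂ] BergmanSpace α H) : Prop :=
  ∀ f : BergmanSpace α H, ∀ z : Disc, T f z = f (Φ z)

end Space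

/-! Everything is read off the matrix of $C_\Phi$ in the functions $z^n y$. The measure $dA_\alpha$
is finite and invariant under rotations, so pairing $f=\sum a_k z^k$ with $z^n y$ isolates one
coefficient: the result is $c_n\langle y,a_n\rangle$, where $c_n=\int|z|^{2n}dA_\alpha\neq0$
(`inner_monomial_left`). Hence, for a unit vector $y$, the $(n,m)$ entry of $C_\Phi$ is $c_n$ times
the coefficient of $z^n$ in $\Phi^m$ (`inner_monomial_map_monomial`).

If $C_\Phi$ is Hermitian, comparing the entries $(n,1)$ and $(1,n)$ ties the $n$-th coefficient
$p_n$ of $\Phi$ to the linear coefficient of $\Phi^n$. For $n=0$ the latter is that of the constant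
$1$, so $p_0=0$. Then $\Phi^n$ vanishes at $0$ to order at least $n$, so $p_n=0$ for $n\ge2$; the
entry $(1,1)$ shows that $p_1$ is real (`eq_mul_of_isSelfAdjoint`). Since $\Phi$ maps the disc into
itself, $|p_1|\le1$.

Conversely, for $\Phi(z)=\lambda z$ with $\lambda$ real, $C_\Phi$ is diagonal with real eigenvalues
$\lambda^n$. Boundedness comes from the point evaluation estimate if $|\lambda|<1$ and from rotation
invariance if $|\lambda|=1$ (`exists_eLpNorm_comp_le`). -/

/-! ### Rotation invariance of the weighted area measure -/

section Rotation

/-- The rotation `z ↦ u z` of the unit disc. -/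
def discRotation (u : Circle) (z : Disc) : Disc :=
  ⟨u * z, by
    rw [mem_ball_zero_iff, norm_mul, Circle.norm_coe, one_mul]
    exact mem_ball_zero_iff.1 z.2⟩

theorem coe_discRotation (u : Circle) (z : Disc) : (discRotation u z : ℂ) = u * z := rfl

theorem continuous_uncurry_discRotation :
    Continuous (fun p : Circle × Disc => discRotation p.1 p.2) := by
  unfold discRotation
  fun_prop

theorem continuous_discRotation (u : Circle) : Continuous (discRotation u) :=
  continuous_uncurry_discRotation.comp (Continuous.prodMk_right u)

theorem measurableEmbedding_disc_coe : MeasurableEmbedding ((↑) : Disc → ℂ) :=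
  MeasurableEmbedding.subtype_coe Metric.isOpen_ball.measurableSet

theorem measurePreserving_discRotation_comap (u : Circle) :
    MeasurePreserving (discRotation u) (Measure.comap ((↑) : Disc → ℂ) volume)
      (Measure.comap ((↑) : Disc → ℂ) volume) := by
  refine ⟨(continuous_discRotation u).measurable, Measure.ext fun s hs => ?_⟩
  rw [Measure.map_apply (continuous_discRotation u).measurable hs,
    measurableEmbedding_disc_coe.comap_apply, measurableEmbedding_disc_coe.comap_apply,
    -- Multiplication by `u` is a linear isometry of the plane, so it preserves Lebesgue measure; it
    -- remains to match preimages in the disc with preimages in the plane.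
    ← (rotation u).measurePreserving.measure_preimage
      (measurableEmbedding_disc_coe.measurableSet_image.2 hs).nullMeasurableSet]
  congr 1
  ext w
  constructor
  · rintro ⟨z, hz, rfl⟩
    exact ⟨_, hz, rfl⟩
  · rintro ⟨v, hv, hvw⟩
    have hw : w ∈ Metric.ball (0 : ℂ) 1 := by
      have h1 : ‖(v : ℂ)‖ < 1 := mem_ball_zero_iff.1 v.2
      rw [hvw, LinearIsometryEquiv.norm_map] at h1
      exact mem_ball_zero_iff.2 h1
    refine ⟨⟨w, hw⟩, ?_, rfl⟩
    have : discRotation u ⟨w, hw⟩ = v := Subtype.ext (by rw [hvw]; rfl)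
    rwa [Set.mem_preimage, this]

/-- The density depends only on $|z|$, so the invariance of Lebesgue measure carries over. -/
theorem measurePreserving_discRotation (α : ℝ) (u : Circle) :
    MeasurePreserving (discRotation u) (weightedArea α) (weightedArea α) := by
  refine ⟨(continuous_discRotation u).measurable, Measure.ext fun s hs => ?_⟩
  rw [Measure.map_apply (continuous_discRotation u).measurable hs, weightedArea,
    withDensity_apply _ ((continuous_discRotation u).measurable hs), withDensity_apply _ hs,
    ← (measurePreserving_discRotation_comap u).setLIntegral_comp_preimage hs (by fun_prop)]
  simp only [coe_discRotation, norm_mul, Circle.norm_coe, one_mul]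

end Rotation

/-! ### Finite total mass -/

section FiniteMass

/-- The integrand is nonnegative and has the antiderivative $-(1-r^2)^{\alpha+1}/(2(\alpha+1))$.
Since $\alpha+1>0$, this is continuous up to $r=1$, even when the weight itself blows up there. -/
theorem lintegral_radial_weight_lt_top {α : ℝ} (hα : -1 < α) :
    ∫⁻ r in Set.Ioo (0 : ℝ) 1, ENNReal.ofReal (r * (1 - r ^ 2) ^ α) < ∞ := by
  have h : IntegrableOn (fun r : ℝ => r * (1 - r ^ 2) ^ α) (Set.Ioc 0 1) := by
    refine intervalIntegral.integrableOn_deriv_of_nonneg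
      (g := fun r => -(1 - r ^ 2) ^ (α + 1) / (2 * (α + 1))) ?_ ?_ ?_
    · refine ContinuousOn.div_const (ContinuousOn.neg ?_) _
      exact ContinuousOn.rpow_const (by fun_prop) fun x _ => Or.inr (by linarith)
    · intro x hx
      have hx1 : 1 - x ^ 2 ≠ 0 := by nlinarith [hx.1, hx.2]
      have h1 : HasDerivAt (fun r : ℝ => 1 - r ^ 2) (-(2 * x)) x := by
        simpa using (hasDerivAt_pow 2 x).const_sub 1
      refine ((h1.rpow_const (p := α + 1) (Or.inl hx1)).neg.div_const
        (2 * (α + 1))).congr_deriv ?_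
      have : α + 1 ≠ 0 := by linarith
      rw [add_sub_cancel_right]
      field_simp
    · intro x hx
      exact mul_nonneg hx.1.le (Real.rpow_nonneg (by nlinarith [hx.1, hx.2]) _)
  have h2 := (h.mono_set Set.Ioo_subset_Ioc_self).2
  refine lt_of_le_of_lt (lintegral_mono fun r => ?_) h2
  exact Real.ofReal_le_enorm _

theorem weightedArea_univ_lt_top {α : ℝ} (hα : -1 < α) : weightedArea α Set.univ < ∞ := by
  set w : ℂ → ℝ≥0∞ := fun z => ENNReal.ofReal ((α + 1) / Real.pi * (1 - ‖z‖ ^ 2) ^ α) with hw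
  have h1 : weightedArea α Set.univ = ∫⁻ z, (Metric.ball (0 : ℂ) 1).indicator w z := by
    rw [weightedArea, withDensity_apply _ MeasurableSet.univ, Measure.restrict_univ,
      ← measurableEmbedding_disc_coe.lintegral_map w, measurableEmbedding_disc_coe.map_comap,
      Subtype.range_coe, lintegral_indicator Metric.isOpen_ball.measurableSet]
  rw [h1, ← Complex.lintegral_comp_polarCoord_symm, polarCoord_target]
  -- The bound is a function of the radius times the constant $1$ in the angle, so that the double
  -- integral splits as a product.
  have h2 : ∀ p ∈ Set.Ioi (0 : ℝ) ×ˢ Set.Ioo (-Real.pi) Real.pi,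
      ENNReal.ofReal p.1 • (Metric.ball (0 : ℂ) 1).indicator w (Complex.polarCoord.symm p) ≤
        (Set.Ioo (0 : ℝ) 1).indicator
          (fun r => ENNReal.ofReal ((α + 1) / Real.pi) * ENNReal.ofReal (r * (1 - r ^ 2) ^ α)) p.1
          * 1 := by
    intro p hp
    have hp1 : 0 < p.1 := hp.1
    have hn : ‖Complex.polarCoord.symm p‖ = p.1 := by
      rw [Complex.norm_polarCoord_symm, abs_of_pos hp1]
    by_cases hb : Complex.polarCoord.symm p ∈ Metric.ball (0 : ℂ) 1
    · have hb' : p.1 < 1 := by rw [← hn]; exact mem_ball_zero_iff.1 hb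
      have hc : 0 ≤ (α + 1) / Real.pi := div_nonneg (by linarith) Real.pi_pos.le
      rw [Set.indicator_of_mem hb, Set.indicator_of_mem (Set.mem_Ioo.2 ⟨hp1, hb'⟩), hw]
      simp only [hn, smul_eq_mul, mul_one]
      rw [← ENNReal.ofReal_mul hp1.le, ← ENNReal.ofReal_mul hc]
      exact ENNReal.ofReal_le_ofReal (le_of_eq (by ring))
    · rw [Set.indicator_of_notMem hb]
      simp
  refine (setLIntegral_mono' (measurableSet_Ioi.prod measurableSet_Ioo) h2).trans_lt ?_
  rw [Measure.volume_eq_prod, ← Measure.prod_restrict, lintegral_prod_mul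
    (Measurable.aemeasurable (Measurable.indicator (by fun_prop) measurableSet_Ioo))
    aemeasurable_const]
  refine ENNReal.mul_lt_top ?_ (by simp)
  refine (setLIntegral_le_lintegral _ _).trans_lt ?_
  rw [lintegral_indicator measurableSet_Ioo, lintegral_const_mul _ (by fun_prop)]
  exact ENNReal.mul_lt_top ENNReal.ofReal_lt_top (lintegral_radial_weight_lt_top hα)

theorem isFiniteMeasure_weightedArea {α : ℝ} (hα : -1 < α) : IsFiniteMeasure (weightedArea α) :=
  ⟨weightedArea_univ_lt_top hα⟩

end FiniteMass

/-! ### Extraction of Taylor coefficients by integration -/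

section Coefficients

theorem integral_circle_pow_mul (n k : ℕ) (a : ℂ) :
    ∫ θ in (0 : ℝ)..(2 * Real.pi),
        (starRingEnd ℂ) (Circle.exp θ : ℂ) ^ n * ((Circle.exp θ : ℂ) ^ k * a) =
      if k = n then 2 * Real.pi * a else 0 := by
  have h : ∀ θ : ℝ, (starRingEnd ℂ) (Circle.exp θ : ℂ) ^ n * ((Circle.exp θ : ℂ) ^ k * a) =
      Complex.exp (((k - n : ℂ) * Complex.I) * θ) * a := fun θ => by
    rw [← Circle.coe_inv_eq_conj, ← Circle.exp_neg, Circle.coe_exp, Circle.coe_exp,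
      ← Complex.exp_nat_mul, ← Complex.exp_nat_mul, ← mul_assoc, ← Complex.exp_add]
    congr 2
    push_cast
    ring
  simp_rw [h]
  rw [intervalIntegral.integral_mul_const]
  split_ifs with hkn
  · subst hkn
    simp
  · have hc : (k - n : ℂ) * Complex.I ≠ 0 :=
      mul_ne_zero (sub_ne_zero.2 (by exact_mod_cast hkn)) Complex.I_ne_zero
    rw [integral_exp_mul_complex hc]
    have h2 : Complex.exp ((k - n : ℂ) * Complex.I * ((2 * Real.pi : ℝ) : ℂ)) = 1 := by
      refine Complex.exp_eq_one_iff.2 ⟨(k : ℤ) - n, ?_⟩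
      push_cast
      ring
    rw [h2]
    simp

/-- The average of `conj (u z) ^ n * g (u z)` over the unit circle picks out the coefficient
of `z ^ n`. -/
theorem integral_circle_conj_pow_mul {g : Disc → ℂ} {b : ℕ → ℂ}
    (hg : ∀ z : Disc, HasSum (fun k => (z : ℂ) ^ k * b k) (g z)) (n : ℕ) (z : Disc) :
    ∫ θ in (0 : ℝ)..(2 * Real.pi), (starRingEnd ℂ) (discRotation (Circle.exp θ) z : ℂ) ^ n *
        g (discRotation (Circle.exp θ) z) =
      2 * Real.pi * ((‖(z : ℂ)‖ ^ (2 * n) : ℝ) * b n) := by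
  have hs : Summable fun k => ‖(starRingEnd ℂ) (z : ℂ) ^ n * ((z : ℂ) ^ k * b k)‖ :=
    ((hg z).summable.mul_left _).norm
  have hterm : ∀ (k : ℕ) (θ : ℝ),
      (starRingEnd ℂ) (discRotation (Circle.exp θ) z : ℂ) ^ n *
        ((discRotation (Circle.exp θ) z : ℂ) ^ k * b k) =
      (starRingEnd ℂ) (Circle.exp θ : ℂ) ^ n * ((Circle.exp θ : ℂ) ^ k *
        ((starRingEnd ℂ) (z : ℂ) ^ n * ((z : ℂ) ^ k * b k))) := fun k θ => by
    rw [coe_discRotation, map_mul]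
    ring
  -- Rotating `z` does not change the modulus of any term, so the absolutely convergent series at
  -- `z` dominates uniformly in the angle.
  have h1 := intervalIntegral.hasSum_integral_of_dominated_convergence (a := 0)
    (b := 2 * Real.pi) (μ := volume)
    (F := fun k θ => (starRingEnd ℂ) (discRotation (Circle.exp θ) z : ℂ) ^ n *
        ((discRotation (Circle.exp θ) z : ℂ) ^ k * b k))
    (f := fun θ => (starRingEnd ℂ) (discRotation (Circle.exp θ) z : ℂ) ^ n *
        g (discRotation (Circle.exp θ) z))
    (fun k _ => ‖(starRingEnd ℂ) (z : ℂ) ^ n * ((z : ℂ) ^ k * b k)‖)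
    (fun k => ?_) (fun k => ?_) ?_ ?_ ?_
  · simp_rw [hterm, integral_circle_pow_mul] at h1
    have h3 := hasSum_single (f := fun k => if k = n then 2 * (Real.pi : ℂ) *
      ((starRingEnd ℂ) (z : ℂ) ^ n * ((z : ℂ) ^ k * b k)) else 0) n fun k hk => if_neg hk
    rw [h1.unique h3, if_pos rfl, ← mul_assoc ((starRingEnd ℂ) (z : ℂ) ^ n), ← mul_pow,
      Complex.conj_mul', pow_mul]
    push_cast
    ring
  · simp only [hterm]
    exact Continuous.aestronglyMeasurable (by fun_prop)
  · refine Eventually.of_forall fun θ _ => ?_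
    rw [hterm]
    simp
  · exact Eventually.of_forall fun θ _ => hs
  · simp
  · exact Eventually.of_forall fun θ _ => (hg _).mul_left _

/-- The integral equals its average over all rotations; by Fubini the circle can be integrated
first, which kills every coefficient but the $n$-th. Thus the power series is integrated termwise
only over circles, never over the whole disc, where it need not converge uniformly. -/
theorem integral_conj_pow_mul {α : ℝ} {g : Disc → ℂ} {b : ℕ → ℂ}
    (hg : ∀ z : Disc, HasSum (fun k => (z : ℂ) ^ k * b k) (g z)) (n : ℕ)
    (hint : Integrable (fun z : Disc => (starRingEnd ℂ) (z : ℂ) ^ n * g z) (weightedArea α))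
    [SFinite (weightedArea α)] :
    ∫ z : Disc, (starRingEnd ℂ) (z : ℂ) ^ n * g z ∂(weightedArea α) =
      (∫ z : Disc, ‖(z : ℂ)‖ ^ (2 * n) ∂(weightedArea α) : ℝ) * b n := by
  have hgc : Continuous g := IsAnalyticOnDisc.continuous ⟨b, by simpa using hg⟩
  set F : Disc → ℂ := fun z => (starRingEnd ℂ) (z : ℂ) ^ n * g z with hF
  have hFc : Continuous F := by fun_prop
  have hrot : ∀ (u : Circle) (G : Disc → ℂ), Continuous G →
      ∫ z, G (discRotation u z) ∂(weightedArea α) = ∫ z, G z ∂(weightedArea α) := by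
    intro u G hG
    have h := measurePreserving_discRotation α u
    conv_rhs => rw [← h.map_eq]
    rw [integral_map h.measurable.aemeasurable hG.aestronglyMeasurable]
  have hjc : Continuous fun p : ℝ × Disc => F (discRotation (Circle.exp p.1) p.2) :=
    hFc.comp (continuous_uncurry_discRotation.comp
      ((Circle.exp.continuous.comp continuous_fst).prodMk continuous_snd))
  have hprod : Integrable (fun p : ℝ × Disc => F (discRotation (Circle.exp p.1) p.2))
      ((volume.restrict (Set.Ioc 0 (2 * Real.pi))).prod (weightedArea α)) := by
    -- By invariance the integral of the norm over the disc is the same for every angle, hence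
    -- integrable over a bounded interval of angles.
    refine (integrable_prod_iff hjc.aestronglyMeasurable).2 ⟨Eventually.of_forall fun θ => ?_, ?_⟩
    · have h := (measurePreserving_discRotation α (Circle.exp θ)).integrable_comp
        (g := F) hFc.aestronglyMeasurable
      exact h.2 hint
    · have : ∀ θ : ℝ, ∫ z, ‖F (discRotation (Circle.exp θ) z)‖ ∂(weightedArea α) =
          ∫ z, ‖F z‖ ∂(weightedArea α) := fun θ => by
        have h := measurePreserving_discRotation α (Circle.exp θ)
        conv_rhs => rw [← h.map_eq]
        rw [integral_map h.measurable.aemeasurable hFc.norm.aestronglyMeasurable]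
      simp only [this]
      exact integrable_const _
  have h1 := integral_integral_swap (f := fun (θ : ℝ) (z : Disc) =>
    F (discRotation (Circle.exp θ) z)) hprod
  have h2 : ∀ z : Disc, ∫ θ in Set.Ioc 0 (2 * Real.pi), F (discRotation (Circle.exp θ) z) =
      2 * Real.pi * ((‖(z : ℂ)‖ ^ (2 * n) : ℝ) * b n) := fun z => by
    rw [← integral_circle_conj_pow_mul hg, intervalIntegral.integral_of_le Real.two_pi_pos.le]
  simp only [hrot _ F hFc, h2] at h1
  rw [integral_const_mul, integral_mul_const, integral_complex_ofReal, integral_const] at h1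
  have hpi : (2 * Real.pi : ℂ) ≠ 0 := by simp [Real.pi_ne_zero]
  refine mul_left_cancel₀ hpi ?_
  rw [← h1]
  simp [Real.pi_pos.le]

end Coefficients

/-! ### Products and powers of power series on the disc -/

section AnalyticOnDisc

theorem IsAnalyticOnDisc.mul {f g : Disc → ℂ} (hf : IsAnalyticOnDisc f)
    (hg : IsAnalyticOnDisc g) : IsAnalyticOnDisc (fun z => f z * g z) := by
  refine isAnalyticOnDisc_of_differentiableOn ((hf.differentiableOn.mul hg.differentiableOn).congr
    fun z hz => ?_)
  simp only [discExtend, dif_pos hz, Pi.mul_apply]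

theorem isAnalyticOnDisc_const (c : ℂ) : IsAnalyticOnDisc (fun _ => c) :=
  isAnalyticOnDisc_of_differentiableOn ((differentiableOn_const c).congr fun z hz => by
    simp only [discExtend, dif_pos hz])

theorem isAnalyticOnDisc_coe : IsAnalyticOnDisc (fun z => (z : ℂ)) :=
  isAnalyticOnDisc_of_differentiableOn (differentiableOn_id.congr fun z hz => by
    simp only [discExtend, dif_pos hz, id])

theorem IsAnalyticOnDisc.pow {f : Disc → ℂ} (hf : IsAnalyticOnDisc f) (n : ℕ) :
    IsAnalyticOnDisc (fun z => f z ^ n) := by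
  induction n with
  | zero => simpa using isAnalyticOnDisc_const 1
  | succ n ih => simpa only [pow_succ] using ih.mul hf

/-- An analytic function whose constant coefficient vanishes is divisible by `z`. -/
theorem exists_eq_coe_mul_of_hasSum {f : Disc → ℂ} {p : ℕ → ℂ}
    (hf : ∀ z : Disc, HasSum (fun n => (z : ℂ) ^ n • p n) (f z)) (h0 : p 0 = 0) :
    ∃ g : Disc → ℂ, IsAnalyticOnDisc g ∧ ∀ z, f z = z * g z := by
  have hs : ∀ z : Disc, HasSum (fun n => (z : ℂ) ^ (n + 1) • p (n + 1)) (f z) := fun z => by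
    have := (hasSum_nat_add_iff' 1).2 (hf z)
    simpa [h0] using this
  have hsum : ∀ z : Disc, Summable (fun n => (z : ℂ) ^ n • p (n + 1)) := fun z => by
    -- Away from the origin the shifted series is the original one divided by `z`; at the origin
    -- only its constant term survives.
    by_cases hz : (z : ℂ) = 0
    · refine summable_of_ne_finset_zero (s := {0}) fun n hn => ?_
      rw [hz, zero_pow (by simpa using hn), zero_smul]
    · refine ((hs z).summable.mul_left ((z : ℂ)⁻¹)).congr fun n => ?_
      rw [smul_eq_mul, smul_eq_mul, pow_succ]
      field_simp
  refine ⟨fun z => ∑' n, (z : ℂ) ^ n • p (n + 1), ⟨_, fun z => (hsum z).hasSum⟩, fun z => ?_⟩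
  refine (hs z).unique ?_
  simpa only [smul_eq_mul, pow_succ', mul_assoc] using (hsum z).hasSum.mul_left (z : ℂ)

/-- The `n`-th power, `n ≥ 2`, of a function vanishing at the origin has no linear term. -/
theorem exists_hasSum_pow_coeff_one_eq_zero {f : Disc → ℂ} {p : ℕ → ℂ}
    (hf : ∀ z : Disc, HasSum (fun n => (z : ℂ) ^ n • p n) (f z)) (h0 : p 0 = 0) {n : ℕ}
    (hn : 2 ≤ n) :
    ∃ q : ℕ → ℂ, (∀ z : Disc, HasSum (fun k => (z : ℂ) ^ k • q k) (f z ^ n)) ∧ q 1 = 0 := by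
  obtain ⟨g, hg, hfg⟩ := exists_eq_coe_mul_of_hasSum hf h0
  obtain ⟨m, rfl⟩ := Nat.exists_eq_add_of_le' hn
  -- With $f=zg$ and $n=m+2$, one has $f^n=z^2\cdot z^m g^{m+2}$. The factor $z^2$ shifts the
  -- coefficients `d` by two places, leaving zeros in degrees $0$ and $1$.
  obtain ⟨d, hd⟩ := (isAnalyticOnDisc_coe.pow m).mul (hg.pow (m + 2))
  refine ⟨fun k => if k < 2 then 0 else d (k - 2), fun z => ?_, by simp⟩
  rw [← hasSum_nat_add_iff' 2]
  have h := (hd z).mul_left ((z : ℂ) ^ 2)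
  have e : f z ^ (m + 2) = (z : ℂ) ^ 2 * ((z : ℂ) ^ m * g z ^ (m + 2)) := by
    rw [hfg]
    ring
  rw [e]
  have e2 : ∀ k, (z : ℂ) ^ 2 * (z : ℂ) ^ k • d k = (z : ℂ) ^ (k + 2) * d k := fun k => by
    rw [smul_eq_mul]
    ring
  simp only [e2] at h
  simpa [Finset.sum_range_succ] using h

theorem hasSum_comp_of_eq_mul {E : Type*} [NormedAddCommGroup E]
    [NormedSpace ℂ E] {Φ : Disc → Disc} {l : ℂ}
    (hl : ∀ z, (Φ z : ℂ) = l * z) {f : Disc → E} {a : ℕ → E}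
    (ha : ∀ z : Disc, HasSum (fun k => (z : ℂ) ^ k • a k) (f z)) (z : Disc) :
    HasSum (fun k => (z : ℂ) ^ k • l ^ k • a k) (f (Φ z)) := by
  convert ha (Φ z) using 2 with k
  rw [hl, smul_smul, mul_pow, mul_comm]

end AnalyticOnDisc

/-! ### Monomials, dilations and matrix coefficients in the Bergman space -/

namespace BergmanSpace

variable {α : ℝ} {H : Type*} [NormedAddCommGroup H] [InnerProductSpace ℂ H] [CompleteSpace H]

theorem ext_apply {f g : BergmanSpace α H} (h : ∀ z, f z = g z) : f = g :=
  Subtype.ext (funext h)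

/-- The function `z ↦ z ^ n • y`. -/
noncomputable def monomial (α : ℝ) [hα : Fact (-1 < α)] (n : ℕ) (y : H) : BergmanSpace α H :=
  have ha : IsAnalyticOnDisc (fun z : Disc => (z : ℂ) ^ n • y) := by
    refine ⟨Pi.single n y, fun z => ?_⟩
    convert hasSum_single n fun k hk => ?_ using 2
    · simp
    · simp [hk]
  have := isFiniteMeasure_weightedArea hα.out
  ⟨fun z => (z : ℂ) ^ n • y, ha, (ha.memLp_iff α).1
    (MemLp.of_bound ha.continuous.aestronglyMeasurable ‖y‖ (Eventually.of_forall fun z => by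
      rw [norm_smul, norm_pow]
      exact mul_le_of_le_one_left (norm_nonneg _)
        (pow_le_one₀ (norm_nonneg _) (mem_ball_zero_iff.1 z.2).le)))⟩

variable [hα : Fact (-1 < α)]

theorem monomial_apply (n : ℕ) (y : H) (z : Disc) : monomial α n y z = (z : ℂ) ^ n • y := rfl

theorem hasSum_monomial (n : ℕ) (y : H) (z : Disc) :
    HasSum (fun k => (z : ℂ) ^ k • (if k = n then y else 0)) (monomial α n y z) := by
  rw [monomial_apply]
  convert hasSum_single n fun k hk => ?_ using 2
  · simp
  · simp [hk]

/-- The moments `∫ |z|^(2n) dA_α`. -/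
noncomputable def moment (α : ℝ) (n : ℕ) : ℝ := ∫ z : Disc, ‖(z : ℂ)‖ ^ (2 * n) ∂(weightedArea α)

/-- Pairing with `y` reduces to the scalar function $\langle y,f(z)\rangle$, whose Taylor
coefficients are $\langle y,a_k\rangle$. -/
theorem inner_monomial_left (n : ℕ) (y : H) (f : BergmanSpace α H) {a : ℕ → H}
    (ha : ∀ z : Disc, HasSum (fun k => (z : ℂ) ^ k • a k) (f z)) :
    inner ℂ (monomial α n y) f = moment α n * inner ℂ y (a n) := by
  have := isFiniteMeasure_weightedArea hα.out
  have hF : ∀ z : Disc, inner ℂ (monomial α n y z) (f z) =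
      (starRingEnd ℂ) (z : ℂ) ^ n * inner ℂ y (f z) := fun z => by
    rw [monomial_apply, inner_smul_left, map_pow]
  have hint : Integrable (fun z => inner ℂ (monomial α n y z) (f z)) (weightedArea α) := by
    refine (L2.integrable_inner ((monomial α n y).memLp.toLp _) (f.memLp.toLp _)).congr ?_
    filter_upwards [(monomial α n y).memLp.coeFn_toLp, f.memLp.coeFn_toLp] with z h1 h2
    rw [h1, h2]
  rw [inner_eq_integral]
  simp only [hF] at hint ⊢
  refine integral_conj_pow_mul (b := fun k => inner ℂ y (a k)) (fun z => ?_) n hint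
  have h := (ha z).mapL (innerSL ℂ y)
  simpa [inner_smul_right] using h

/-- The moment is the squared norm of $z^n$ in the scalar space $H=\mathbb C$; were it zero, $z^n$
would vanish at $1/2$. -/
theorem moment_ne_zero (n : ℕ) : moment α n ≠ 0 := by
  intro h
  have h1 := inner_monomial_left n (1 : ℂ) (monomial α n (1 : ℂ)) (hasSum_monomial n 1)
  rw [h, Complex.ofReal_zero, zero_mul, inner_self_eq_zero] at h1
  have h2 : monomial α n (1 : ℂ) ⟨1 / 2, by rw [mem_ball_zero_iff]; norm_num⟩ = 0 := by
    rw [h1]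
    rfl
  rw [monomial_apply] at h2
  simp at h2

/-- An element of the Bergman space is determined by its inner products with the monomials. -/
theorem ext_inner_monomial {f g : BergmanSpace α H}
    (h : ∀ (n : ℕ) (y : H), inner ℂ (monomial α n y) f = inner ℂ (monomial α n y) g) : f = g := by
  obtain ⟨a, ha⟩ := f.isAnalytic
  obtain ⟨b, hb⟩ := g.isAnalytic
  refine ext_apply fun z => ?_
  -- Nonzero moments recover every coefficient, so density of the polynomials is not needed.
  have hab : a = b := funext fun n => ext_inner_left ℂ fun y => by
    have := h n y
    rw [inner_monomial_left n y f ha, inner_monomial_left n y g hb] at this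
    exact mul_left_cancel₀ (by exact_mod_cast moment_ne_zero n) this
  subst hab
  exact (ha z).unique (hb z)

/-- If $|l|<1$, the image of $\Phi$ lies in the disc of radius $|l|$, where point evaluations are
uniformly bounded, and the total mass is finite. If $|l|=1$, $\Phi$ is a rotation and the norm is
preserved. -/
theorem exists_eLpNorm_comp_le {Φ : Disc → Disc} {l : ℝ} (h1 : |l| ≤ 1)
    (hl : ∀ z, (Φ z : ℂ) = (l : ℂ) * z) :
    ∃ C : ℝ≥0∞, C ≠ ∞ ∧ ∀ f : BergmanSpace α H,
      eLpNorm (fun z => f (Φ z)) 2 (weightedArea α) ≤ C * ‖f‖ₑ := by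
  rcases h1.lt_or_eq with h1 | h1
  · have := isFiniteMeasure_weightedArea hα.out
    obtain ⟨C, hC, h⟩ := exists_enorm_apply_le (α := α) (H := H) h1
    refine ⟨C * weightedArea α Set.univ ^ (1 / 2 : ℝ), ENNReal.mul_ne_top hC
      (ENNReal.rpow_ne_top_of_nonneg (by norm_num) (measure_ne_top _ _)), fun f => ?_⟩
    have hb : ∀ z, ‖f (Φ z)‖ₑ ≤ C * ‖f‖ₑ := fun z => h f (Φ z) (by
      rw [hl, norm_mul, Complex.norm_real, Real.norm_eq_abs]
      exact mul_le_of_le_one_right (abs_nonneg l) (mem_ball_zero_iff.1 z.2).le)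
    refine (eLpNorm_le_of_ae_enorm_bound (Eventually.of_forall hb)).trans (le_of_eq ?_)
    simp only [smul_eq_mul, ENNReal.toReal_ofNat]
    rw [one_div]
    ring
  · have hu : (l : ℂ) ∈ Submonoid.unitSphere ℂ := by
      simpa [Submonoid.unitSphere] using h1
    have hΦ : Φ = discRotation ⟨l, hu⟩ := funext fun z => Subtype.ext (hl z)
    refine ⟨1, ENNReal.one_ne_top, fun f => ?_⟩
    rw [one_mul, enorm_eq_eLpNorm, hΦ]
    exact (eLpNorm_comp_measurePreserving f.memLp.1 (measurePreserving_discRotation α _)).le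

theorem exists_isCompositionOperator {Φ : Disc → Disc} {l : ℝ} (h1 : |l| ≤ 1)
    (hl : ∀ z, (Φ z : ℂ) = (l : ℂ) * z) :
    ∃ T : BergmanSpace α H →L[ℂ] BergmanSpace α H, IsCompositionOperator Φ T := by
  obtain ⟨C, hC, h⟩ := exists_eLpNorm_comp_le (α := α) (H := H) h1 hl
  have ha : ∀ f : BergmanSpace α H, IsAnalyticOnDisc (fun z => f (Φ z)) := fun f => by
    obtain ⟨a, ha⟩ := f.isAnalytic
    exact ⟨_, hasSum_comp_of_eq_mul hl ha⟩
  let S : BergmanSpace α H →ₗ[ℂ] BergmanSpace α H :=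
    { toFun := fun f => ⟨fun z => f (Φ z), ha f, ((ha f).memLp_iff α).1
        ⟨(ha f).continuous.aestronglyMeasurable,
          (h f).trans_lt (ENNReal.mul_lt_top hC.lt_top enorm_lt_top)⟩⟩
      map_add' := fun f g => rfl
      map_smul' := fun c f => rfl }
  refine ⟨S.mkContinuous C.toReal fun f => ?_, fun f z => rfl⟩
  have h2 : ‖S f‖ₑ ≤ C * ‖f‖ₑ := (enorm_eq_eLpNorm (S f)).trans_le (h f)
  have h3 := ENNReal.toReal_mono (ENNReal.mul_ne_top hC enorm_ne_top) h2
  rwa [ENNReal.toReal_mul, toReal_enorm, toReal_enorm] at h3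

/-- Moving `T` onto a monomial produces the conjugate of $l^n$, while applying it to `f` multiplies
the $n$-th coefficient by $l^n$; these agree because `l` is real. -/
theorem isSelfAdjoint_of_eq_mul {Φ : Disc → Disc} {l : ℝ} (hl : ∀ z, (Φ z : ℂ) = (l : ℂ) * z)
    {T : BergmanSpace α H →L[ℂ] BergmanSpace α H} (hT : IsCompositionOperator Φ T) :
    IsSelfAdjoint T := by
  rw [ContinuousLinearMap.isSelfAdjoint_iff']
  refine ContinuousLinearMap.ext fun f => ext_inner_monomial fun n y => ?_
  obtain ⟨a, ha⟩ := f.isAnalytic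
  have hTm : T (monomial α n y) = (l : ℂ) ^ n • monomial α n y := ext_apply fun z => by
    rw [hT, monomial_apply, hl, mul_pow, mul_smul]
    rfl
  have hTf : ∀ z : Disc, HasSum (fun k => (z : ℂ) ^ k • (l : ℂ) ^ k • a k) (T f z) := fun z => by
    rw [hT]
    exact hasSum_comp_of_eq_mul hl ha z
  rw [ContinuousLinearMap.adjoint_inner_right, hTm, inner_smul_left, inner_monomial_left n y f ha,
    inner_monomial_left n y _ hTf, inner_smul_right, map_pow, Complex.conj_ofReal]
  ring

/-- The matrix coefficients of a composition operator in the monomials. -/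
theorem inner_monomial_map_monomial {Φ : Disc → Disc}
    {T : BergmanSpace α H →L[ℂ] BergmanSpace α H} (hT : IsCompositionOperator Φ T)
    {m : ℕ} {q : ℕ → ℂ} (hq : ∀ z : Disc, HasSum (fun k => (z : ℂ) ^ k • q k) ((Φ z : ℂ) ^ m))
    (n : ℕ) {y : H} (hy : ‖y‖ = 1) :
    inner ℂ (monomial α n y) (T (monomial α m y)) = moment α n * q n := by
  rw [inner_monomial_left n y _ (a := fun k => q k • y) fun z => ?_, inner_smul_right,
    inner_self_eq_norm_sq_to_K, hy]
  · simp
  · rw [hT, monomial_apply]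
    simpa [smul_smul] using (hq z).smul_const y

theorem eq_mul_of_isSelfAdjoint [Nontrivial H] {Φ : Disc → Disc}
    (hΦ : IsAnalyticOnDisc (fun z => (Φ z : ℂ))) {T : BergmanSpace α H →L[ℂ] BergmanSpace α H}
    (hT : IsCompositionOperator Φ T) (hs : IsSelfAdjoint T) :
    ∃ l : ℝ, ∀ z, (Φ z : ℂ) = (l : ℂ) * z := by
  obtain ⟨p, hp⟩ := hΦ
  obtain ⟨y, hy⟩ := exists_norm_eq H zero_le_one
  have hsym : ∀ f g : BergmanSpace α H, inner ℂ f (T g) = (starRingEnd ℂ) (inner ℂ g (T f)) :=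
    fun f g => by
      rw [inner_conj_symm, ← ContinuousLinearMap.adjoint_inner_right, hs.adjoint_eq]
  have hp1 : ∀ z : Disc, HasSum (fun k => (z : ℂ) ^ k • p k) ((Φ z : ℂ) ^ 1) := by simpa using hp
  have hmom : ∀ n, (moment α n : ℂ) ≠ 0 := fun n => by exact_mod_cast moment_ne_zero n
  -- Symmetry between the entries $(n,1)$ and $(1,n)$: up to nonzero moments, $p_n$ is the conjugate
  -- of the linear coefficient of $\Phi^n$.
  have hvanish : ∀ n (q : ℕ → ℂ), (∀ z : Disc, HasSum (fun k => (z : ℂ) ^ k • q k)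
      ((Φ z : ℂ) ^ n)) → q 1 = 0 → p n = 0 := fun n q hq hq1 => by
    have h := hsym (monomial α n y) (monomial α 1 y)
    rw [inner_monomial_map_monomial hT hp1 n hy, inner_monomial_map_monomial hT hq 1 hy, hq1,
      mul_zero, map_zero] at h
    exact (mul_eq_zero.1 h).resolve_left (hmom n)
  have h0 : p 0 = 0 := by
    -- $\Phi^0=1$ has no linear term. This case has to come before $n\ge2$, where $\Phi(0)=0$ is
    -- used.
    refine hvanish 0 (fun k => if k = 0 then 1 else 0) (fun z => ?_) (by simp)
    convert hasSum_single 0 fun k hk => ?_ using 2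
    · simp
    · simp [hk]
  have h2 : ∀ n, n ≠ 1 → p n = 0 := fun n hn => by
    rcases Nat.lt_or_ge n 2 with h | h
    · obtain rfl : n = 0 := by omega
      exact h0
    · obtain ⟨q, hq, hq1⟩ := exists_hasSum_pow_coeff_one_eq_zero hp h0 h
      exact hvanish n q hq hq1
  -- A diagonal entry of a Hermitian matrix is real.
  have h1 : (starRingEnd ℂ) (p 1) = p 1 := by
    have h := hsym (monomial α 1 y) (monomial α 1 y)
    rw [inner_monomial_map_monomial hT hp1 1 hy, map_mul, Complex.conj_ofReal] at h
    exact (mul_left_cancel₀ (hmom 1) h).symm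
  refine ⟨(p 1).re, fun z => (hp z).unique ?_⟩
  rw [Complex.conj_eq_iff_re.1 h1]
  convert hasSum_single 1 fun k hk => ?_ using 2
  · simp [mul_comm]
  · simp [h2 k hk]

end BergmanSpace

/-- If $|l|>1$, the point $1/l$ of the disc would be sent to $1$, outside the disc. -/
theorem abs_le_one_of_eq_mul {Φ : Disc → Disc} {l : ℝ} (hl : ∀ z, (Φ z : ℂ) = (l : ℂ) * z) :
    |l| ≤ 1 := by
  by_contra! h
  have hl0 : (l : ℂ) ≠ 0 := by
    rintro h0
    rw [Complex.ofReal_eq_zero.1 h0, abs_zero] at h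
    linarith
  have hz : (l : ℂ)⁻¹ ∈ Metric.ball (0 : ℂ) 1 := by
    rw [mem_ball_zero_iff, norm_inv, Complex.norm_real]
    exact inv_lt_one_of_one_lt₀ h
  have h1 := mem_ball_zero_iff.1 (Φ ⟨_, hz⟩).2
  rw [hl, mul_inv_cancel₀ hl0, norm_one] at h1
  exact lt_irrefl _ h1

theorem mainTheorem6 (α : ℝ) [Fact (-1 < α)] (H : Type*) [NormedAddCommGroup H]
    [InnerProductSpace ℂ H] [CompleteSpace H] [TopologicalSpace.SeparableSpace H] [Nontrivial H]
    (Φ : Disc → Disc) (hΦ : IsAnalyticOnDisc (fun z => (Φ z : ℂ))) :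
    (∃ T : BergmanSpace α H →L[ℂ] BergmanSpace α H, IsCompositionOperator Φ T ∧ IsSelfAdjoint T) ↔
      ∃ l : ℝ, |l| ≤ 1 ∧ ∀ z : Disc, (Φ z : ℂ) = (l : ℂ) * (z : ℂ) := by
  constructor
  · rintro ⟨T, hT, hs⟩
    obtain ⟨l, hl⟩ := BergmanSpace.eq_mul_of_isSelfAdjoint hΦ hT hs
    exact ⟨l, abs_le_one_of_eq_mul hl, hl⟩
  · rintro ⟨l, h1, hl⟩
    obtain ⟨T, hT⟩ := BergmanSpace.exists_isCompositionOperator (α := α) (H := H) h1 hl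
    exact ⟨T, hT, BergmanSpace.isSelfAdjoint_of_eq_mul hl hT⟩
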